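/- \textbf{Setting.} Let $(A^+,\Delta)$ be a monoidal Garside structure: $A^+$ is a cancellative monoid, noetherian for factors (every sequence in which each term is a factor of the previous one is eventually constant), whose left- and right-divisibility are lattice orders; there is an automorphism $\Phi$ of $A^+$ with $v\Delta=\Delta\Phi(v)$ for all $v$; and every atom $v$ has some $\overline v$ with $v\overline v=\Delta$ and $\overline v\,\Phi(v)=\Delta$. Let $S$ be the set of atoms of $A^+$ and $A$ its group of fractions. Write $\vee,\wedge$ for lcm and gcd for left-divisibility. A submonoid $P\subseteq A^+$ is \emph{parabolic} if it is closed under lcm's and gcd's for left- and for right-divisibility and there is $\delta\in A^+$ with $P\delta=\delta P$ such that $\{x: x \text{ left-divides }\delta\}=\{x\in P: x\text{ left-divides }\Delta\}=\{\Delta\wedge p: p\in P\}$. A parabolic submonoid with atom set $X$ is denoted $A_X^+$; the subgroup $A_X$ of $A$ generated by it is called a standard parabolic subgroup (and $A_X^+=A_X\cap A^+$). The positive ribbon category $\mathcal R^+(A^+)$ has the parabolic submonoids as objects, the $g\in A^+$ with $A_X^+g=gA_Y^+$ as morphisms $A_X^+\to A_Y^+$, and the product (first $g$, then $h$, giving $gh$)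 as composition; its atoms are the non-identity morphisms that are not a composite of two non-identity morphisms. The ribbon groupoid $\mathcal R(A)$ has the standard parabolic subgroups as objects and the $g\in A$ with $g^{-1}A_Xg=A_Y$ and $g^{-1}A_X^+g=A_Y^+$ as morphisms $A_X\to A_Y$. A \emph{$\nu$-function} assigns to every parabolic submonoid $A_X^+$ a map $\nu_X$ from $S$ to the morphisms of $\mathcal R^+(A^+)$ with source $A_X^+$ such that, for all $s,t\in S$: (a) $\nu_X(s)$ is an atom of $\mathcal R^+(A^+)$; (b) if $s$ left-divides a morphism $g$ of $\mathcal R^+(A^+)$ with source $A_X^+$, then $\nu_X(s)$ left-divides $g$; (c) $\nu_X(s)\vee\nu_X(t)$ is a morphism of $\mathcal R^+(A^+)$ with source $A_X^+$. A $\tilde\nu$-function is defined symmetrically, with morphisms of target $A_X^+$ and right-divisibility. Assume that $A^+$ has a $\nu$-structure, i.e. a $\nu$-function $\nu$ and a $\tilde\nu$-function. Let $\mathcal A$ be the quiver whose vertices are the standard parabolic subgroups of $A$ and whose edges from $A_X$ to $A_Y$ are the elements $\nu_X(s)$, $s\in S$, that are morphisms $A_X^+\to A_Y^+$ of $\mathcal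 R^+(A^+)$ (one edge for each element, even if it equals $\nu_X(s)$ for several $s$). Write $\tau(X,s)$ for $\nu_X(s)$ when $\nu_X(s)\in A_X^+$, and $\nu(X,s)$ for $\nu_X(s)$ when $\nu_X(s)\notin A_X^+$. \textbf{Theorem.} Let $R$ be the set of all equalities between paths of $\mathcal A$ with common source and common target, of one of the forms \begin{enumerate} \item $\tau(X,s)\,\tau(X,t)=\tau(X,t)\,\tau(X,s)$; \item $\tau(X,s)\,\nu(X,t)=\nu(X,t)\,\tau(Y,s')$, where $\nu(X,t)$ has target $A_Y$; \item $\nu(X,s)\,\nu(Y_1,s_1)\cdots\nu(Y_k,s_k)=\nu(X,t)\,\nu(Z_1,t_1)\cdots\nu(Z_\ell,t_\ell)$, with $k,\ell\ge 0$, where both sides are decompositions of $\nu(X,s)\vee\nu(X,t)$, \end{enumerate} that hold in $\mathcal R^+(A^+)$. Then $\langle\mathcal A,R\rangle$ is a presentation of $\mathcal R(A)$ as a groupoid: the canonical functor from the free groupoid on $\mathcal A$ to $\mathcal R(A)$ is surjective, and it induces an isomorphism from the groupoid of formal inverses of the category $\mathcal C(\mathcal A,\equiv_R)$ onto $\mathcal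 R(A)$, where $\mathcal C(\mathcal A,\equiv_R)$ is the quotient of the free category on $\mathcal A$ by the congruence generated by $R$. -/

import Mathlib

open CategoryTheory

namespace Ribbon

universe u

/-! ## Divisibility in a monoid

Left-divisibility is Mathlib's `a ∣ b`, that is `∃ c, b = a * c`; right-divisibility is Mathlib's
`RightDvd a b`, that is `∃ c, b = c * a`. -/

section Divisibility

variable {M : Type u} [Monoid M]

/-- `m` is the lcm of `a` and `b` for left-divisibility. -/
def IsLeftLcm (a b m : M) : Prop := a ∣ m ∧ b ∣ m ∧ ∀ c, a ∣ c → b ∣ c → m ∣ c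

/-- `m` is the gcd of `a` and `b` for left-divisibility. -/
def IsLeftGcd (a b m : M) : Prop := m ∣ a ∧ m ∣ b ∧ ∀ c, c ∣ a → c ∣ b → c ∣ m

/-- `m` is the lcm of `a` and `b` for right-divisibility. -/
def IsRightLcm (a b m : M) : Prop :=
  RightDvd a m ∧ RightDvd b m ∧ ∀ c, RightDvd a c → RightDvd b c → RightDvd m c

/-- `m` is the gcd of `a` and `b` for right-divisibility. -/
def IsRightGcd (a b m : M) : Prop :=
  RightDvd m a ∧ RightDvd m b ∧ ∀ c, RightDvd c a → RightDvd c b → RightDvd c m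

/-- Atoms of a monoid: non-identity elements that are not a product of two non-identity
elements. -/
def IsMonoidAtom (s : M) : Prop := s ≠ 1 ∧ ∀ b c, s = b * c → b = 1 ∨ c = 1

/-- `P g = g Q` as sets, that is `g⁻¹ P g = Q`. -/
def Conjugates (P Q : Submonoid M) (g : M) : Prop :=
  (∀ p ∈ P, ∃ q ∈ Q, p * g = g * q) ∧ (∀ q ∈ Q, ∃ p ∈ P, p * g = g * q)

theorem Conjugates.one (P : Submonoid M) : Conjugates P P 1 :=
  ⟨fun p hp => ⟨p, hp, by simp⟩, fun p hp => ⟨p, hp, by simp⟩⟩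

theorem Conjugates.mul {P Q R : Submonoid M} {g h : M} (h₁ : Conjugates P Q g)
    (h₂ : Conjugates Q R h) : Conjugates P R (g * h) := by
  refine ⟨fun p hp => ?_, fun r hr => ?_⟩
  · obtain ⟨q, hq, e⟩ := h₁.1 p hp
    obtain ⟨r, hr, e'⟩ := h₂.1 q hq
    exact ⟨r, hr, by rw [← mul_assoc, e, mul_assoc, e', mul_assoc]⟩
  · obtain ⟨q, hq, e'⟩ := h₂.2 r hr
    obtain ⟨p, hp, e⟩ := h₁.2 q hq
    exact ⟨p, hp, by rw [← mul_assoc, e, mul_assoc, e', mul_assoc]⟩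

theorem Conjugates.inv {A : Type u} [Group A] {P Q : Submonoid A} {g : A}
    (h : Conjugates P Q g) : Conjugates Q P g⁻¹ := by
  refine ⟨fun q hq => ?_, fun p hp => ?_⟩
  · obtain ⟨p, hp, e⟩ := h.2 q hq
    exact ⟨p, hp, by rw [eq_inv_mul_iff_mul_eq, ← mul_assoc, ← e, mul_inv_cancel_right]⟩
  · obtain ⟨q, hq, e⟩ := h.1 p hp
    exact ⟨q, hq, by rw [eq_inv_mul_iff_mul_eq, ← mul_assoc, ← e, mul_inv_cancel_right]⟩

end Divisibility

/-! ## Garside monoids, their groups of fractions and parabolic submonoids -/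

section Garside

variable {M : Type u} [Monoid M]

/-- `(M, Δ)` is a monoidal Garside structure: `Δ` is a natural transformation from the identity
to an automorphism `Φ` of `M`, every atom `v` has a complement `v'` making the two triangles
commute, `M` is cancellative and noetherian for factors, and both divisibility relations are
lattice orders. -/
structure IsGarside (Δ : M) : Prop where
  exists_auto : ∃ Φ : M ≃* M, (∀ v, v * Δ = Δ * Φ v) ∧
    ∀ v, IsMonoidAtom v → ∃ v', v * v' = Δ ∧ v' * Φ v = Δ
  left_cancel : ∀ a b c : M, a * b = a * c → b = c
  right_cancel : ∀ a b c : M, b * a = c * a → b = c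
  noetherian : ∀ w : ℕ → M, (∀ n, ∃ x y, w n = x * w (n + 1) * y) → ∃ N, ∀ n, N ≤ n → w n = w N
  left_lcm : ∀ a b : M, ∃ m, IsLeftLcm a b m
  left_gcd : ∀ a b : M, ∃ m, IsLeftGcd a b m
  right_lcm : ∀ a b : M, ∃ m, IsRightLcm a b m
  right_gcd : ∀ a b : M, ∃ m, IsRightGcd a b m

variable (M) in
/-- The group of formal inverses (group of fractions) of `M`: the group generated by the elements
of `M` subject to the multiplication table of `M`. -/
abbrev FracGroup : Type u :=
  PresentedGroup {r : FreeGroup M | ∃ a b : M,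
    r = FreeGroup.of (a * b) * (FreeGroup.of a * FreeGroup.of b)⁻¹}

theorem FracGroup.of_mul (a b : M) :
    (PresentedGroup.of (a * b) : FracGroup M) = PresentedGroup.of a * PresentedGroup.of b := by
  have h := PresentedGroup.one_of_mem (rels := {r : FreeGroup M | ∃ a b : M,
    r = FreeGroup.of (a * b) * (FreeGroup.of a * FreeGroup.of b)⁻¹}) ⟨a, b, rfl⟩
  rw [map_mul, map_inv, map_mul, mul_inv_eq_one] at h
  exact h

/-- The canonical homomorphism from `M` to its group of fractions. -/
def FracGroup.ι : M →* FracGroup M where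
  toFun a := PresentedGroup.of a
  map_one' := by
    have h := FracGroup.of_mul (1 : M) 1
    rw [mul_one] at h
    exact left_eq_mul.mp h
  map_mul' := FracGroup.of_mul

/-- `P` is a parabolic submonoid of `(M, Δ)`: it is a sublattice for left- and for
right-divisibility, and there is `δ` with `δ⁻¹ P δ = P` such that
`[1, δ] = [1, Δ] ∩ P = Δ ∧ P` for left-divisibility in `M`. -/
structure IsParabolic (Δ : M) (P : Submonoid M) : Prop where
  left_lcm : ∀ a ∈ P, ∀ b ∈ P, ∀ m, IsLeftLcm a b m → m ∈ P
  left_gcd : ∀ a ∈ P, ∀ b ∈ P, ∀ m, IsLeftGcd a b m → m ∈ P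
  right_lcm : ∀ a ∈ P, ∀ b ∈ P, ∀ m, IsRightLcm a b m → m ∈ P
  right_gcd : ∀ a ∈ P, ∀ b ∈ P, ∀ m, IsRightGcd a b m → m ∈ P
  exists_delta : ∃ δ : M, Conjugates P P δ ∧
    (∀ x, x ∣ δ ↔ x ∣ Δ ∧ x ∈ P) ∧ (∀ x, x ∣ δ ↔ ∃ p ∈ P, IsLeftGcd Δ p x)

/-! ## The positive ribbon category and ν-structures -/

/-- `g` is a morphism from `P` to `Q` in the positive ribbon category of `(M, Δ)`, whose objects
are the parabolic submonoids and whose composition is the product of `M`. -/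
structure IsPosRibbon (Δ : M) (P Q : Submonoid M) (g : M) : Prop where
  source : IsParabolic Δ P
  target : IsParabolic Δ Q
  conj : Conjugates P Q g

/-- `g` is an atom of the positive ribbon category, from `P` to `Q`. -/
def IsRibbonAtom (Δ : M) (P Q : Submonoid M) (g : M) : Prop :=
  IsPosRibbon Δ P Q g ∧ g ≠ 1 ∧
    ∀ (R : Submonoid M) (h k : M), IsPosRibbon Δ P R h → IsPosRibbon Δ R Q k → g = h * k →
      h = 1 ∨ k = 1

/-- `ν P s`, for `P` a parabolic submonoid and `s` an atom, is a ν-function. (The values at other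
arguments are irrelevant.) -/
def IsNuFunction (Δ : M) (ν : Submonoid M → M → M) : Prop :=
  ∀ P, IsParabolic Δ P →
    (∀ s, IsMonoidAtom s → ∃ Q, IsRibbonAtom Δ P Q (ν P s)) ∧
    (∀ s, IsMonoidAtom s → ∀ Q g, IsPosRibbon Δ P Q g → s ∣ g → ν P s ∣ g) ∧
    (∀ s t, IsMonoidAtom s → IsMonoidAtom t →
      ∀ l, IsLeftLcm (ν P s) (ν P t) l → ∃ Q, IsPosRibbon Δ P Q l)

/-- `ν' P s`, for `P` a parabolic submonoid and `s` an atom, is a `ν̃`-function. (The values at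
other arguments are irrelevant.) -/
def IsNuTildeFunction (Δ : M) (ν' : Submonoid M → M → M) : Prop :=
  ∀ P, IsParabolic Δ P →
    (∀ s, IsMonoidAtom s → ∃ Q, IsRibbonAtom Δ Q P (ν' P s)) ∧
    (∀ s, IsMonoidAtom s → ∀ Q g, IsPosRibbon Δ Q P g → RightDvd s g → RightDvd (ν' P s) g) ∧
    (∀ s t, IsMonoidAtom s → IsMonoidAtom t →
      ∀ l, IsRightLcm (ν' P s) (ν' P t) l → ∃ Q, IsPosRibbon Δ Q P l)

/-! ## The ribbon groupoid -/

/-- The standard parabolic subgroups of the group of fractions of `M`: the subgroups generated by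
the parabolic submonoids of `(M, Δ)`. -/
structure ParabolicSubgroup (Δ : M) where
  grp : Subgroup (FracGroup M)
  exists_submonoid : ∃ P : Submonoid M, IsParabolic Δ P ∧
    grp = Subgroup.closure (FracGroup.ι '' (P : Set M))

namespace ParabolicSubgroup

variable {Δ : M}

/-- The submonoid `H ∩ M` of a standard parabolic subgroup `H`; it is the parabolic submonoid that
generates `H`. -/
def pos (H : ParabolicSubgroup Δ) : Submonoid M := H.grp.toSubmonoid.comap FracGroup.ι

theorem grp_eq_closure (H : ParabolicSubgroup Δ) :
    H.grp = Subgroup.closure (FracGroup.ι '' (H.pos : Set M)) := by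
  apply le_antisymm
  · obtain ⟨P, -, e⟩ := H.exists_submonoid
    conv_lhs => rw [e]
    apply Subgroup.closure_mono
    apply Set.image_mono
    intro p hp
    change FracGroup.ι p ∈ H.grp
    rw [e]
    exact Subgroup.subset_closure ⟨p, hp, rfl⟩
  · rw [Subgroup.closure_le]
    rintro _ ⟨p, hp, rfl⟩
    exact hp

/-- `g` is a ribbon from `H` to `K`: `g⁻¹ H g = K` and `g⁻¹ H⁺ g = K⁺`, where `H⁺` and `K⁺` are
the images in the group of fractions of the parabolic submonoids that generate `H` and `K`. -/
def IsRibbon (H K : ParabolicSubgroup Δ) (g : FracGroup M) : Prop :=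
  Conjugates H.grp.toSubmonoid K.grp.toSubmonoid g ∧
    Conjugates (H.pos.map FracGroup.ι) (K.pos.map FracGroup.ι) g

/-- The ribbon groupoid: its objects are the standard parabolic subgroups, its morphisms are the
ribbons, and the composite of `g` followed by `h` is `g * h`. -/
instance ribbonGroupoid : Groupoid (ParabolicSubgroup Δ) where
  Hom H K := {g : FracGroup M // IsRibbon H K g}
  id _ := ⟨1, Conjugates.one _, Conjugates.one _⟩
  comp f g := ⟨f.1 * g.1, f.2.1.mul g.2.1, f.2.2.mul g.2.2⟩
  id_comp f := Subtype.ext (one_mul f.1)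
  comp_id f := Subtype.ext (mul_one f.1)
  assoc f g h := Subtype.ext (mul_assoc f.1 g.1 h.1)
  inv f := ⟨f.1⁻¹, f.2.1.inv, f.2.2.inv⟩
  inv_comp f := Subtype.ext (inv_mul_cancel f.1)
  comp_inv f := Subtype.ext (mul_inv_cancel f.1)

/-- The image in the group of fractions of an element `g` with `g⁻¹ H⁺ g = K⁺` is a ribbon. -/
theorem isRibbon_ι {H K : ParabolicSubgroup Δ} {g : M} (h : Conjugates H.pos K.pos g) :
    IsRibbon H K (FracGroup.ι g) := by
  refine ⟨⟨fun x hx => ?_, fun y hy => ?_⟩, ⟨?_, ?_⟩⟩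
  · refine ⟨(FracGroup.ι g)⁻¹ * x * FracGroup.ι g, ?_, by group⟩
    change x ∈ H.grp at hx
    change _ ∈ K.grp
    rw [grp_eq_closure] at hx
    induction hx using Subgroup.closure_induction with
    | mem x hx =>
      obtain ⟨p, hp, rfl⟩ := hx
      obtain ⟨q, hq, e⟩ := h.1 p hp
      have e' := congrArg FracGroup.ι e
      rw [map_mul, map_mul] at e'
      rw [mul_assoc, e', inv_mul_cancel_left]
      exact hq
    | one => simp
    | mul x y _ _ hx hy =>
      have := mul_mem hx hy
      convert this using 1
      group
    | inv x _ hx =>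
      have := inv_mem hx
      convert this using 1
      group
  · refine ⟨FracGroup.ι g * y * (FracGroup.ι g)⁻¹, ?_, by group⟩
    change y ∈ K.grp at hy
    change _ ∈ H.grp
    rw [grp_eq_closure] at hy
    induction hy using Subgroup.closure_induction with
    | mem x hx =>
      obtain ⟨q, hq, rfl⟩ := hx
      obtain ⟨p, hp, e⟩ := h.2 q hq
      have e' := congrArg FracGroup.ι e
      rw [map_mul, map_mul] at e'
      rw [← e', mul_inv_cancel_right]
      exact hp
    | one => simp
    | mul x y _ _ hx hy =>
      have := mul_mem hx hy
      convert this using 1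
      group
    | inv x _ hx =>
      have := inv_mem hx
      convert this using 1
      group
  · rintro _ ⟨p, hp, rfl⟩
    obtain ⟨q, hq, e⟩ := h.1 p hp
    exact ⟨_, ⟨q, hq, rfl⟩, by rw [← map_mul, ← map_mul, e]⟩
  · rintro _ ⟨q, hq, rfl⟩
    obtain ⟨p, hp, e⟩ := h.2 q hq
    exact ⟨_, ⟨p, hp, rfl⟩, by rw [← map_mul, ← map_mul, e]⟩

end ParabolicSubgroup

/-! ## The quiver of the ν-function and the defining relations -/

/-- The vertices of the quiver whose edges are the values of the ν-function: the standard
parabolic subgroups. -/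
def NuQuiver (Δ : M) (_ν : Submonoid M → M → M) : Type u := ParabolicSubgroup Δ

namespace NuQuiver

variable {Δ : M} {ν : Submonoid M → M → M}

/-- The parabolic subgroup underlying a vertex. -/
def toParabolic (X : NuQuiver Δ ν) : ParabolicSubgroup Δ := X

/-- The parabolic submonoid attached to a vertex. -/
def pos (X : NuQuiver Δ ν) : Submonoid M := X.toParabolic.pos

/-- The edges from `X` to `Y` are the elements `ν_X(s)`, for `s` an atom, that belong to the
positive ribbon category and have target `Y`. An element of the form `ν_X(s)` for several
atoms `s` gives one edge. -/
instance : Quiver (NuQuiver Δ ν) where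
  Hom X Y := {g : M // (∃ s, IsMonoidAtom s ∧ g = ν X.pos s) ∧ IsPosRibbon Δ X.pos Y.pos g}

/-- The element of `M` carried by an edge. -/
def val {X Y : NuQuiver Δ ν} (a : X ⟶ Y) : M := a.1

/-- The canonical map from the quiver to the ribbon groupoid: the identity on vertices, and the
inclusion of `M` in its group of fractions on edges. -/
def toRibbon (Δ : M) (ν : Submonoid M → M → M) : NuQuiver Δ ν ⥤q ParabolicSubgroup Δ where
  obj X := X.toParabolic
  map a := ⟨FracGroup.ι (val a), ParabolicSubgroup.isRibbon_ι a.2.2.conj⟩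

/-- The product in `M` of the edges of a path. -/
def pathVal {X : NuQuiver Δ ν} : {Y : NuQuiver Δ ν} → Quiver.Path X Y → M
  | _, .nil => 1
  | _, .cons p a => pathVal p * val a

/-- An edge `ν_X(s)` is of type `τ` if it belongs to the parabolic submonoid of `X`; it is then
written `τ(X,s)`. -/
def IsTau {X Y : NuQuiver Δ ν} (a : X ⟶ Y) : Prop := val a ∈ X.pos

/-- An edge `ν_X(s)` is of type `ν` if it does not belong to the parabolic submonoid of `X`; it is
then written `ν(X,s)`. -/
def IsNu {X Y : NuQuiver Δ ν} (a : X ⟶ Y) : Prop := val a ∉ X.pos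

/-- All the edges of a path are of type `ν`. -/
def IsNuPath {X : NuQuiver Δ ν} : {Y : NuQuiver Δ ν} → Quiver.Path X Y → Prop
  | _, .nil => True
  | _, .cons p a => IsNuPath p ∧ IsNu a

/-- The defining relations. -/
inductive Rel (Δ : M) (ν : Submonoid M → M → M) : HomRel (Paths (NuQuiver Δ ν))
  /-- `τ(X,s) τ(X,t) = τ(X,t) τ(X,s)`. -/
  | tau_tau {X : NuQuiver Δ ν} (a b : X ⟶ X) (ha : IsTau a) (hb : IsTau b)
      (h : val a * val b = val b * val a) :
      Rel Δ ν (a.toPath.comp b.toPath) (b.toPath.comp a.toPath)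
  /-- `τ(X,s) ν(X,t) = ν(X,t) τ(Y,s')`. -/
  | tau_nu {X Y : NuQuiver Δ ν} (a : X ⟶ X) (b : X ⟶ Y) (c : Y ⟶ Y)
      (ha : IsTau a) (hb : IsNu b) (hc : IsTau c) (h : val a * val b = val b * val c) :
      Rel Δ ν (a.toPath.comp b.toPath) (b.toPath.comp c.toPath)
  /-- `ν(X,s) ν(Y₁,s₁) ⋯ ν(Yₖ,sₖ) = ν(X,t) ν(Z₁,t₁) ⋯ ν(Zₗ,tₗ)`, where both sides are equal to the
  lcm of `ν(X,s)` and `ν(X,t)` for left-divisibility. -/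
  | lcm {X Y Z W : NuQuiver Δ ν} (a : X ⟶ Y) (b : X ⟶ Z) (p : Quiver.Path Y W)
      (q : Quiver.Path Z W) (ha : IsNu a) (hb : IsNu b) (hp : IsNuPath p) (hq : IsNuPath q)
      (h₁ : IsLeftLcm (val a) (val b) (val a * pathVal p))
      (h₂ : val a * pathVal p = val b * pathVal q) :
      Rel Δ ν (a.toPath.comp p) (b.toPath.comp q)

end NuQuiver

end Garside

/-! ## Presentations of groupoids -/

section Presentation

variable {V C : Type*}

/-- The quiver `V`, mapped to the groupoid `C` by `φ`, generates `C` as a groupoid: the vertices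
are identified with the objects, the edges are morphisms of `C`, and the induced functor from the
free groupoid on `V` is surjective. -/
structure GeneratesGroupoid [Quiver V] [Groupoid C] (φ : V ⥤q C) : Prop where
  obj_bijective : Function.Bijective φ.obj
  map_injective : ∀ X Y : V, Function.Injective (φ.map : (X ⟶ Y) → (φ.obj X ⟶ φ.obj Y))
  map_surjective : ∀ X Y : FreeGroupoid (Paths V), Function.Surjective
    ((FreeGroupoid.lift (Paths.lift φ)).map : (X ⟶ Y) → _)

/-- An isomorphism of categories: a functor that is bijective on objects and on morphisms. -/
structure IsCatIso {D E : Type*} [Category D] [Category E] (F : D ⥤ E) : Prop where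
  obj_bijective : Function.Bijective F.obj
  map_bijective : ∀ X Y : D, Function.Bijective (F.map : (X ⟶ Y) → (F.obj X ⟶ F.obj Y))

/-- `⟨V, r⟩` is a presentation of the groupoid `C`: `V` generates `C` as a groupoid, the relations
`r` between paths hold in `C`, and the functor to `C` from the groupoid of formal inverses of the
quotient of the free category on `V` by the congruence generated by `r` is an isomorphism. -/
def IsGroupoidPresentation [Quiver V] [Groupoid C] (φ : V ⥤q C) (r : HomRel (Paths V)) : Prop :=
  GeneratesGroupoid φ ∧
    ∃ h : ∀ (X Y : Paths V) (p q : X ⟶ Y), r p q → (Paths.lift φ).map p = (Paths.lift φ).map q,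
      IsCatIso (FreeGroupoid.lift (CategoryTheory.Quotient.lift r (Paths.lift φ) h))

end Presentation

end Ribbon

namespace Ribbon

universe u

variable {M : Type u} [Monoid M] {Δ : M}

/-! ## Garside monoids: cancellation, noetherianity and atoms -/

namespace IsGarside

/-! The presentation is first established for the positive ribbon category and then transferred to
fractions.

Positive part. By (a), (b) and noetherianity, the edges are exactly the atoms of the ribbon
category, and every positive ribbon is the value of a path (`exists_pathVal_eq`). By (c), the lcm of
two edges with the same source is a ribbon. Two paths with the same value are equivalent by
noetherian induction (`pathClass_eq_of_pathVal_eq`): if their first edges `a` and `b` differ, both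
paths pass through the lcm of `a` and `b` up to equivalence of shorter tails. It remains to compare
the two decompositions of that lcm. If `a` is of type `τ`, the lcm is `a * b` (`isLeftLcm_mul`),
which gives the first two kinds of relation. If neither is of type `τ`, no `τ` edge can occur in the
lcm (`isNuPath_of_isLeftLcm`), which gives the third kind.

Fractions. `M` embeds in its group of fractions, and a parabolic submonoid is recovered from the
subgroup it generates; this rests on closure under factors and on powers of `δ` as common
denominators. Powers of `Δ` carry parabolics to parabolics, and every element divides such a power.
Hence every ribbon is a fraction of positive ones, and the category defined by the relations has
common right multiples, so its faithful functor to the ribbon groupoid stays faithful on formal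
inverses. -/

theorem eq_one_of_mul_eq_one (hΔ : IsGarside Δ) {a b : M} (h : a * b = 1) : a = 1 := by
  -- The sequence `a, 1, a, 1, …` is a chain of factors, because `1 = 1 * a * b`.
  obtain ⟨N, hN⟩ := hΔ.noetherian (fun n => if Even n then a else 1) (by
    intro n
    by_cases hn : Even n
    · exact ⟨a, 1, by simp [hn, Nat.even_add_one]⟩
    · exact ⟨1, b, by simp [hn, Nat.even_add_one, h]⟩)
  by_cases hn : Even N
  · simpa [hn, Nat.even_add_one, eq_comm] using hN (N + 1) (by omega)
  · simpa [hn, Nat.even_add_one] using hN (N + 1) (by omega)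

theorem eq_one_of_mul_eq_one' (hΔ : IsGarside Δ) {a b : M} (h : a * b = 1) : b = 1 := by
  have := hΔ.eq_one_of_mul_eq_one h
  rwa [this, one_mul] at h

/-- Proper factors form a well-founded relation. -/
theorem wellFounded_properFactor (hΔ : IsGarside Δ) :
    WellFounded (fun b a : M => b ≠ a ∧ ∃ x y, a = x * b * y) := by
  rw [wellFounded_iff_isEmpty_descending_chain]
  refine ⟨fun ⟨w, hw⟩ => ?_⟩
  obtain ⟨N, hN⟩ := hΔ.noetherian w fun n => (hw n).2
  exact (hw N).1 (hN (N + 1) (by omega))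

theorem eq_one_of_eq_mul_mul (hΔ : IsGarside Δ) {a x y : M} (h : a = x * a * y) :
    x = 1 ∧ y = 1 := by
  -- The sequence `a, a * y, a, …` is a chain of factors, because `a = x * (a * y)`.
  obtain ⟨N, hN⟩ := hΔ.noetherian (fun n => if Even n then a else a * y) (by
    intro n
    by_cases hn : Even n
    · exact ⟨x, 1, by simp [hn, Nat.even_add_one, ← mul_assoc, ← h]⟩
    · exact ⟨1, y, by simp [hn, Nat.even_add_one]⟩)
  have hay : a * y = a := by
    by_cases hn : Even N
    · simpa [hn, Nat.even_add_one] using hN (N + 1) (by omega)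
    · simpa [hn, Nat.even_add_one, eq_comm] using hN (N + 1) (by omega)
  have hy : y = 1 := hΔ.left_cancel a _ _ (by rw [hay, mul_one])
  refine ⟨hΔ.right_cancel a _ _ ?_, hy⟩
  rw [hy, mul_one] at h
  rw [one_mul, ← h]

theorem exists_atom_dvd (hΔ : IsGarside Δ) {a : M} (ha : a ≠ 1) :
    ∃ s, IsMonoidAtom s ∧ s ∣ a := by
  induction a using hΔ.wellFounded_properFactor.induction with
  | _ a ih =>
    by_cases hat : IsMonoidAtom a
    · exact ⟨a, hat, dvd_rfl⟩
    · simp only [IsMonoidAtom, not_and, not_forall, not_or] at hat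
      obtain ⟨b, c, rfl, hb, hc⟩ := hat ha
      obtain ⟨s, hs, hsb⟩ := ih b
        ⟨fun e => hc (hΔ.left_cancel b _ _ (by rw [← e, mul_one])), 1, c, by simp⟩ hb
      exact ⟨s, hs, hsb.mul_right c⟩

theorem dvd_antisymm (hΔ : IsGarside Δ) {a b : M} (h₁ : a ∣ b) (h₂ : b ∣ a) : a = b := by
  obtain ⟨c, rfl⟩ := h₁
  obtain ⟨d, hd⟩ := h₂
  rw [mul_assoc] at hd
  have : c * d = 1 := hΔ.left_cancel a _ _ (by rw [← hd, mul_one])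
  rw [hΔ.eq_one_of_mul_eq_one this, mul_one]

theorem atom_dvd (hΔ : IsGarside Δ) {s : M} (hs : IsMonoidAtom s) : s ∣ Δ := by
  obtain ⟨Φ, -, h⟩ := hΔ.exists_auto
  obtain ⟨v', hv, -⟩ := h s hs
  exact ⟨v', hv.symm⟩

/-- Induction on an element of `M`, removing atoms on the left. -/
theorem atom_induction (hΔ : IsGarside Δ) {p : M → Prop} (one : p 1)
    (mul : ∀ s a, IsMonoidAtom s → p a → p (s * a)) (a : M) : p a := by
  induction a using hΔ.wellFounded_properFactor.induction with
  | _ a ih =>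
    by_cases ha : a = 1
    · rwa [ha]
    · obtain ⟨s, hs, b, rfl⟩ := hΔ.exists_atom_dvd ha
      refine mul s b hs (ih b ⟨fun e => hs.1 (hΔ.right_cancel b _ _ ?_), s, 1, by simp⟩)
      rw [one_mul, ← e]

end IsGarside

/-! ## Conjugation -/

namespace Conjugates

variable {P Q Q' R : Submonoid M} {g h : M}

theorem target_unique (hΔ : IsGarside Δ) (h₁ : Conjugates P Q g) (h₂ : Conjugates P Q' g) :
    Q = Q' := by
  have key : ∀ {Q Q' : Submonoid M}, Conjugates P Q g → Conjugates P Q' g → Q ≤ Q' := by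
    intro Q Q' h₁ h₂ q hq
    obtain ⟨p, hp, e⟩ := h₁.2 q hq
    obtain ⟨q', hq', e'⟩ := h₂.1 p hp
    rwa [hΔ.left_cancel g q q' (by rw [← e, ← e'])]
  exact le_antisymm (key h₁ h₂) (key h₂ h₁)

theorem of_mul_left (hΔ : IsGarside Δ) (h₁ : Conjugates P R (g * h)) (h₂ : Conjugates P Q g) :
    Conjugates Q R h := by
  refine ⟨fun q hq => ?_, fun r hr => ?_⟩
  · obtain ⟨p, hp, e⟩ := h₂.2 q hq
    obtain ⟨r, hr, e'⟩ := h₁.1 p hp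
    exact ⟨r, hr, hΔ.left_cancel g _ _ (by rw [← mul_assoc, ← e, mul_assoc, e', mul_assoc])⟩
  · obtain ⟨p, hp, e'⟩ := h₁.2 r hr
    obtain ⟨q, hq, e⟩ := h₂.1 p hp
    exact ⟨q, hq, hΔ.left_cancel g _ _ (by rw [← mul_assoc, ← e, mul_assoc, e', mul_assoc])⟩

theorem of_mul_right (hΔ : IsGarside Δ) (h₁ : Conjugates P R (g * h)) (h₂ : Conjugates Q R h) :
    Conjugates P Q g := by
  refine ⟨fun p hp => ?_, fun q hq => ?_⟩
  · obtain ⟨r, hr, e'⟩ := h₁.1 p hp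
    obtain ⟨q, hq, e⟩ := h₂.2 r hr
    exact ⟨q, hq, hΔ.right_cancel h _ _ (by rw [mul_assoc, e', mul_assoc, ← e, ← mul_assoc])⟩
  · obtain ⟨r, hr, e⟩ := h₂.1 q hq
    obtain ⟨p, hp, e'⟩ := h₁.2 r hr
    exact ⟨p, hp, hΔ.right_cancel h _ _ (by rw [mul_assoc, e', mul_assoc, ← e, ← mul_assoc])⟩

theorem pow (h : Conjugates P P g) (n : ℕ) : Conjugates P P (g ^ n) := by
  induction n with
  | zero => simpa using Conjugates.one P
  | succ n ih => rw [pow_succ]; exact ih.mul h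

end Conjugates

/-! ## Parabolic submonoids are closed under factors -/

namespace IsParabolic

variable {P : Submonoid M}

/-- An atom divides `Δ`, so here it divides `Δ ∧ p`, which divides `δ`, and all left-divisors of `δ`
lie in `P`. -/
theorem atom_dvd_mem (hΔ : IsGarside Δ) (hP : IsParabolic Δ P) {s p : M} (hs : IsMonoidAtom s)
    (hp : p ∈ P) (h : s ∣ p) : s ∈ P := by
  obtain ⟨δ, -, h₁, h₂⟩ := hP.exists_delta
  obtain ⟨m, hm⟩ := hΔ.left_gcd Δ p
  exact ((h₁ s).1 ((hm.2.2 s (hΔ.atom_dvd hs) h).trans ((h₂ m).2 ⟨p, hp, hm⟩))).2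

/-- Right-divisors of `δ` are also left-divisors: if `x * y = δ` and `x * δ = δ * x'`, cancelling
`x` gives `δ = y * x'`. -/
theorem exists_balanced_delta (hΔ : IsGarside Δ) (hP : IsParabolic Δ P) :
    ∃ δ ∈ P, Conjugates P P δ ∧ (∀ x, x ∣ δ → x ∈ P) ∧
      (∀ s ∈ P, IsMonoidAtom s → s ∣ δ) ∧ ∀ x y, x * y = δ → y ∣ δ := by
  obtain ⟨δ, h, h₁, -⟩ := hP.exists_delta
  refine ⟨δ, ((h₁ δ).1 dvd_rfl).2, h, fun x hx => ((h₁ x).1 hx).2,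
    fun s hs hat => (h₁ s).2 ⟨hΔ.atom_dvd hat, hs⟩, ?_⟩
  intro x y hxy
  obtain ⟨x', -, e⟩ := h.1 x ((h₁ x).1 ⟨y, hxy.symm⟩).2
  refine ⟨x', hΔ.left_cancel x _ _ ?_⟩
  rw [e, ← mul_assoc, hxy]

/-- Atoms are peeled off on the left. If `s * x * δ ^ n` lies in `P`, then `δ = s * t` with `t` in
`P`; moving one more `δ` across and cancelling `s` puts `x * δ ^ (n + 1)` in `P`. The exponent
grows, hence the quantifier over `n`. -/
theorem mem_of_mul_pow_mem (hΔ : IsGarside Δ) {δ : M} (hδ : Conjugates P P δ)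
    (hdvd : ∀ x, x ∣ δ → x ∈ P) (hat : ∀ s p, IsMonoidAtom s → p ∈ P → s ∣ p → s ∈ P ∧ s ∣ δ)
    (hbal : ∀ x y, x * y = δ → y ∣ δ) (x : M) : ∀ n : ℕ, x * δ ^ n ∈ P → x ∈ P := by
  induction x using hΔ.atom_induction with
  | one => exact fun _ _ => P.one_mem
  | mul s x hs ih =>
    intro n hn
    obtain ⟨hsP, t, ht⟩ := hat s _ hs hn (by rw [mul_assoc]; exact dvd_mul_right _ _)
    refine P.mul_mem hsP (ih (n + 1) ?_)
    obtain ⟨q, hq, e⟩ := hδ.2 _ hn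
    obtain ⟨r, hr, e'⟩ := hδ.1 _ hn
    have : x * δ ^ (n + 1) = t * r := by
      apply hΔ.left_cancel s
      rw [← mul_assoc, ← mul_assoc, ← ht, ← e', pow_succ]
      simp only [mul_assoc]
    rw [this]
    exact P.mul_mem (hdvd t (hbal s t ht.symm)) hr

/-- Makes powers of `δ` common denominators for `P`: elements of `P` divide them within `P`, and
membership in `P` can be tested after multiplying by them. -/
theorem mem_of_mul_delta_pow_mem (hΔ : IsGarside Δ) (hP : IsParabolic Δ P) :
    ∃ δ ∈ P, Conjugates P P δ ∧ (∀ x ∈ P, ∃ n, ∃ y ∈ P, x * y = δ ^ n) ∧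
      ∀ x : M, ∀ n : ℕ, x * δ ^ n ∈ P → x ∈ P := by
  obtain ⟨δ, hδP, hδ, hdvd, hat, hbal⟩ := hP.exists_balanced_delta hΔ
  have key := mem_of_mul_pow_mem hΔ hδ hdvd (fun s p hs hp hsp =>
    ⟨hP.atom_dvd_mem hΔ hs hp hsp, hat s (hP.atom_dvd_mem hΔ hs hp hsp) hs⟩) hbal
  have conj_dvd : ∀ x y, x ∣ δ → x * δ = δ * y → y ∣ δ := by
    rintro x y ⟨z, hz⟩ e
    refine hbal z y (hΔ.left_cancel x _ _ ?_)
    rw [e, ← mul_assoc, ← hz]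
  -- Conjugation by `δ ^ n` keeps an atom `s` of `P` among the divisors of `δ`, so `s * δ ^ n = δ ^
  -- n * z` can be completed to `δ ^ (n + 1)`.
  have conj_pow : ∀ n s, s ∣ δ → ∃ y, y ∣ δ ∧ s * δ ^ n = δ ^ n * y := by
    intro n s hs
    induction n with
    | zero => exact ⟨s, hs, by simp⟩
    | succ n ih =>
      obtain ⟨y, hy, e⟩ := ih
      obtain ⟨z, -, e'⟩ := hδ.1 y (hdvd y hy)
      exact ⟨z, conj_dvd y z hy e', by rw [pow_succ, ← mul_assoc, e, mul_assoc, e', mul_assoc]⟩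
  refine ⟨δ, hδP, hδ, fun x => ?_, key⟩
  induction x using hΔ.atom_induction with
  | one => exact fun _ => ⟨0, 1, P.one_mem, by simp⟩
  | mul s x hs ih =>
    intro hx
    have hsP := hP.atom_dvd_mem hΔ hs hx (dvd_mul_right _ _)
    obtain ⟨t, ht⟩ := hat s hsP hs
    have hxP : x ∈ P := by
      obtain ⟨r, hr, e⟩ := hδ.1 _ hx
      refine key x 1 ?_
      have : x * δ ^ 1 = t * r := by
        apply hΔ.left_cancel s
        rw [← mul_assoc, ← mul_assoc, ← ht, ← e, pow_one]
      rw [this]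
      exact P.mul_mem (hdvd t (hbal s t ht.symm)) hr
    obtain ⟨n, y, hy, e⟩ := ih hxP
    obtain ⟨z, ⟨w, hw⟩, e'⟩ := conj_pow n s ⟨t, ht⟩
    refine ⟨n + 1, y * w, P.mul_mem hy (hdvd w (hbal z w hw.symm)), ?_⟩
    rw [← mul_assoc, mul_assoc s x y, e, e', mul_assoc, ← hw, pow_succ]

/-- A parabolic submonoid contains the factors of its elements. -/
theorem factor_mem (hΔ : IsGarside Δ) (hP : IsParabolic Δ P) {x y : M} (h : x * y ∈ P) :
    x ∈ P ∧ y ∈ P := by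
  obtain ⟨δ, hδP, hδ, hpow, key⟩ := hP.mem_of_mul_delta_pow_mem hΔ
  induction x using hΔ.atom_induction with
  | one => exact ⟨P.one_mem, by simpa using h⟩
  | mul s x hs ih =>
    have hsP := hP.atom_dvd_mem hΔ hs h (by rw [mul_assoc]; exact dvd_mul_right _ _)
    obtain ⟨n, z, hz, e⟩ := hpow s hsP
    -- With `s * z = δ ^ n` and `s * x * y * δ ^ n = δ ^ n * r`, cancelling `s` gives `x * y * δ ^ n
    -- = z * r`, an element of `P`.
    have : x * y ∈ P := by
      obtain ⟨r, hr, e'⟩ := (hδ.pow n).1 _ h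
      obtain ⟨s', hs', e₁⟩ := (hδ.pow n).1 _ hsP
      have hz' : z * s' = δ ^ n := hΔ.left_cancel s _ _ (by rw [← mul_assoc, e, e₁])
      refine key _ n ?_
      have : x * y * δ ^ n = z * r := by
        apply hΔ.left_cancel s
        rw [← mul_assoc s z, e, ← e']
        simp only [mul_assoc]
      rw [this]
      exact P.mul_mem hz hr
    exact ⟨P.mul_mem hsP (ih this).1, (ih this).2⟩

end IsParabolic

/-! ## Embedding in the group of fractions -/

/-- A cancellative monoid with common left multiples embeds in its group of fractions. -/
theorem FracGroup.ι_injective_of_ore (hl : ∀ a b c : M, a * b = a * c → b = c)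
    (hr : ∀ a b c : M, b * a = c * a → b = c)
    (hm : ∀ a b : M, ∃ c d, c * a = d * b) :
    Function.Injective (FracGroup.ι : M →* FracGroup M) := by
  choose c d hcd using hm
  let : OreLocalization.OreSet (⊤ : Submonoid M) :=
    { ore_right_cancel := fun a b s h => ⟨1, by rw [hr _ _ _ h]⟩
      oreNum := fun a s => d a s
      oreDenom := fun a s => ⟨c a s, trivial⟩
      ore_eq := fun a s => hcd a s }
  -- In the localization at all of `M` every numerator is a unit; the units form a group, so the map
  -- from `M` extends to `FracGroup M`.
  let f : M →* (OreLocalization (⊤ : Submonoid M) M)ˣ :=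
    IsUnit.liftRight OreLocalization.numeratorHom fun a =>
      OreLocalization.numerator_isUnit (⟨a, trivial⟩ : (⊤ : Submonoid M))
  have hf : ∀ a, (f a : OreLocalization (⊤ : Submonoid M) M) = OreLocalization.numeratorHom a :=
    fun a => rfl
  let F : FracGroup M →* (OreLocalization (⊤ : Submonoid M) M)ˣ :=
    PresentedGroup.toGroup (f := f) (by
      rintro _ ⟨a, b, rfl⟩
      simp)
  intro a b hab
  have h := congrArg F hab
  have hF : ∀ a, F (FracGroup.ι a) = f a := fun a => PresentedGroup.toGroup.of _
  rw [hF, hF, Units.ext_iff, hf, hf, OreLocalization.numeratorHom_apply,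
    OreLocalization.numeratorHom_apply, OreLocalization.oreDiv_eq_iff] at h
  obtain ⟨u, v, h₁, h₂⟩ := h
  simp only [OneMemClass.coe_one, mul_one] at h₂
  rw [← h₂] at h₁
  exact (hl _ _ _ h₁).symm

theorem IsGarside.ι_injective (hΔ : IsGarside Δ) :
    Function.Injective (FracGroup.ι : M →* FracGroup M) := by
  refine FracGroup.ι_injective_of_ore hΔ.left_cancel hΔ.right_cancel fun a b => ?_
  obtain ⟨m, ⟨c, hc⟩, ⟨d, hd⟩, -⟩ := hΔ.right_lcm a b
  exact ⟨c, d, by rw [← hc, ← hd]⟩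

/-- Elements of the subgroup generated by a submonoid in which every element divides a power of
a quasi-central element `δ` are fractions with a power of `δ` as denominator. -/
theorem exists_eq_mul_inv_of_mem_closure {P : Submonoid M} {δ : M} (hδP : δ ∈ P)
    (hδ : Conjugates P P δ) (hpow : ∀ x ∈ P, ∃ n, ∃ y ∈ P, x * y = δ ^ n) {g : FracGroup M}
    (hg : g ∈ Subgroup.closure (FracGroup.ι '' (P : Set M))) :
    ∃ p ∈ P, ∃ n : ℕ, g * FracGroup.ι (δ ^ n) = FracGroup.ι p := by
  induction hg using Subgroup.closure_induction with
  | mem x hx =>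
    obtain ⟨p, hp, rfl⟩ := hx
    exact ⟨p, hp, 0, by simp⟩
  | one => exact ⟨1, P.one_mem, 0, by simp⟩
  | mul x y _ _ hx hy =>
    obtain ⟨p, hp, n, e⟩ := hx
    obtain ⟨q, hq, m, e'⟩ := hy
    obtain ⟨r, hr, e₁⟩ := (hδ.pow n).1 q hq
    refine ⟨p * r, P.mul_mem hp hr, m + n, ?_⟩
    rw [pow_add, map_mul, ← mul_assoc, mul_assoc x, e', mul_assoc, ← map_mul, e₁, map_mul,
      ← mul_assoc, e, map_mul]
  | inv x _ hx =>
    obtain ⟨p, hp, n, e⟩ := hx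
    obtain ⟨m, y, hy, e'⟩ := hpow p hp
    refine ⟨δ ^ n * y, P.mul_mem (P.pow_mem hδP n) hy, m, ?_⟩
    rw [inv_mul_eq_iff_eq_mul, map_mul, ← mul_assoc, e, ← map_mul, e']

/-- The intersection with `M` of the subgroup generated by a parabolic submonoid. -/
theorem IsParabolic.mem_of_ι_mem_closure (hΔ : IsGarside Δ) {P : Submonoid M}
    (hP : IsParabolic Δ P) {x : M}
    (hx : FracGroup.ι x ∈ Subgroup.closure (FracGroup.ι '' (P : Set M))) : x ∈ P := by
  obtain ⟨δ, hδP, hδ, hpow, key⟩ := hP.mem_of_mul_delta_pow_mem hΔ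
  obtain ⟨p, hp, n, e⟩ := exists_eq_mul_inv_of_mem_closure hδP hδ hpow hx
  rw [← map_mul] at e
  exact key x n (by rwa [hΔ.ι_injective e])

/-- Every element divides a power of `Δ`. -/
theorem IsGarside.exists_mul_eq_pow (hΔ : IsGarside Δ) (x : M) : ∃ n, ∃ y, x * y = Δ ^ n := by
  -- `s * Δ ^ n` divides `Δ ^ (n + 1)`: slide `s` through one `Δ`, which turns it into the atom `Φ
  -- s`, and use the smaller exponent.
  have hat : ∀ n : ℕ, ∀ s, IsMonoidAtom s → ∃ c, s * Δ ^ n * c = Δ ^ (n + 1) := by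
    intro n s hs
    obtain ⟨Φ, h, h'⟩ := hΔ.exists_auto
    induction n generalizing s with
    | zero =>
      obtain ⟨c, hc, -⟩ := h' s hs
      exact ⟨c, by simpa using hc⟩
    | succ n ih =>
      have hs' : IsMonoidAtom (Φ s) := by
        refine ⟨by simpa using hs.1, fun b c e => ?_⟩
        have := hs.2 (Φ.symm b) (Φ.symm c) (by rw [← map_mul, ← e, MulEquiv.symm_apply_apply])
        simpa using this
      obtain ⟨c, hc⟩ := ih _ hs'
      exact ⟨c, by rw [pow_succ', ← mul_assoc, h, mul_assoc, mul_assoc, ← mul_assoc (Φ s), hc,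
        ← pow_succ']⟩
  induction x using hΔ.atom_induction with
  | one => exact ⟨0, 1, by simp⟩
  | mul s x hs ih =>
    obtain ⟨n, y, e⟩ := ih
    obtain ⟨c, hc⟩ := hat n s hs
    exact ⟨n + 1, y * c, by rw [← hc, ← e]; simp only [mul_assoc]⟩

theorem IsGarside.conjugates_top (hΔ : IsGarside Δ) :
    Conjugates (⊤ : Submonoid M) ⊤ Δ := by
  obtain ⟨Φ, h, -⟩ := hΔ.exists_auto
  exact ⟨fun p _ => ⟨Φ p, trivial, h p⟩, fun q _ => ⟨Φ.symm q, trivial, by simp [h]⟩⟩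

theorem FracGroup.closure_range_ι :
    Subgroup.closure (FracGroup.ι '' ((⊤ : Submonoid M) : Set M)) = ⊤ := by
  have := PresentedGroup.closure_range_of {r : FreeGroup M | ∃ a b : M,
    r = FreeGroup.of (a * b) * (FreeGroup.of a * FreeGroup.of b)⁻¹}
  rw [← this]
  congr 1
  ext x
  simp [FracGroup.ι]

theorem IsGarside.exists_frac (hΔ : IsGarside Δ) (g : FracGroup M) :
    ∃ (a : M) (n : ℕ), g * FracGroup.ι (Δ ^ n) = FracGroup.ι a := by
  obtain ⟨a, -, n, e⟩ := exists_eq_mul_inv_of_mem_closure (P := ⊤) (δ := Δ) trivial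
    hΔ.conjugates_top (fun x _ => by
      obtain ⟨n, y, e⟩ := hΔ.exists_mul_eq_pow x
      exact ⟨n, y, trivial, e⟩) (g := g) (by rw [FracGroup.closure_range_ι]; trivial)
  exact ⟨a, n, e⟩

/-! ## Conjugation of parabolic submonoids by the Garside element -/

/-- Automorphisms fixing `Δ` preserve parabolic submonoids. -/
theorem IsParabolic.map (Φ : M ≃* M) (hΦ : Φ Δ = Δ) {P : Submonoid M} (hP : IsParabolic Δ P) :
    IsParabolic Δ (P.map Φ.toMonoidHom) := by
  have hd : ∀ a b, Φ a ∣ Φ b ↔ a ∣ b := fun a b => map_dvd_iff Φ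
  have hrd : ∀ a b, RightDvd (Φ a) (Φ b) ↔ RightDvd a b := by
    refine fun a b => ⟨fun ⟨c, hc⟩ => ⟨Φ.symm c, Φ.injective (by simpa using hc)⟩,
      fun ⟨c, hc⟩ => ⟨Φ c, by rw [hc, map_mul]⟩⟩
  have hll : ∀ a b m, IsLeftLcm (Φ a) (Φ b) (Φ m) ↔ IsLeftLcm a b m := by
    intro a b m
    exact and_congr (hd _ _) (and_congr (hd _ _)
      (Φ.surjective.forall.trans (by simp only [hd])))
  have hlg : ∀ a b m, IsLeftGcd (Φ a) (Φ b) (Φ m) ↔ IsLeftGcd a b m := by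
    intro a b m
    exact and_congr (hd _ _) (and_congr (hd _ _)
      (Φ.surjective.forall.trans (by simp only [hd])))
  have hrl : ∀ a b m, IsRightLcm (Φ a) (Φ b) (Φ m) ↔ IsRightLcm a b m := by
    intro a b m
    exact and_congr (hrd _ _) (and_congr (hrd _ _)
      (Φ.surjective.forall.trans (by simp only [hrd])))
  have hrg : ∀ a b m, IsRightGcd (Φ a) (Φ b) (Φ m) ↔ IsRightGcd a b m := by
    intro a b m
    exact and_congr (hrd _ _) (and_congr (hrd _ _)
      (Φ.surjective.forall.trans (by simp only [hrd])))
  have hmem : ∀ m, Φ m ∈ P.map Φ.toMonoidHom ↔ m ∈ P := by simp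
  obtain ⟨δ, hc, h₁, h₂⟩ := hP.exists_delta
  refine ⟨?_, ?_, ?_, ?_, Φ δ, ⟨?_, ?_⟩, ?_, ?_⟩
  · rintro _ ⟨a, ha, rfl⟩ _ ⟨b, hb, rfl⟩ m hm
    obtain ⟨m, rfl⟩ := Φ.surjective m
    exact (hmem m).2 (hP.left_lcm a ha b hb m ((hll a b m).1 hm))
  · rintro _ ⟨a, ha, rfl⟩ _ ⟨b, hb, rfl⟩ m hm
    obtain ⟨m, rfl⟩ := Φ.surjective m
    exact (hmem m).2 (hP.left_gcd a ha b hb m ((hlg a b m).1 hm))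
  · rintro _ ⟨a, ha, rfl⟩ _ ⟨b, hb, rfl⟩ m hm
    obtain ⟨m, rfl⟩ := Φ.surjective m
    exact (hmem m).2 (hP.right_lcm a ha b hb m ((hrl a b m).1 hm))
  · rintro _ ⟨a, ha, rfl⟩ _ ⟨b, hb, rfl⟩ m hm
    obtain ⟨m, rfl⟩ := Φ.surjective m
    exact (hmem m).2 (hP.right_gcd a ha b hb m ((hrg a b m).1 hm))
  · rintro _ ⟨a, ha, rfl⟩
    obtain ⟨b, hb, e⟩ := hc.1 a ha
    exact ⟨Φ b, ⟨b, hb, rfl⟩, by simpa using congrArg Φ e⟩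
  · rintro _ ⟨a, ha, rfl⟩
    obtain ⟨b, hb, e⟩ := hc.2 a ha
    exact ⟨Φ b, ⟨b, hb, rfl⟩, by simpa using congrArg Φ e⟩
  · intro x
    obtain ⟨x, rfl⟩ := Φ.surjective x
    rw [hd, hmem, h₁, ← hd x Δ, hΦ]
  · intro x
    obtain ⟨x, rfl⟩ := Φ.surjective x
    rw [hd, h₂]
    refine Iff.trans (exists_congr fun p => ?_) Φ.surjective.exists.symm
    rw [hmem, ← hlg, hΦ]

/-- The conjugate of a parabolic submonoid by a power of `Δ` is parabolic. -/
theorem IsParabolic.exists_conjugates_pow (hΔ : IsGarside Δ) {P : Submonoid M}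
    (hP : IsParabolic Δ P) (n : ℕ) : ∃ Q, IsParabolic Δ Q ∧ Conjugates P Q (Δ ^ n) := by
  obtain ⟨Φ, h, -⟩ := hΔ.exists_auto
  have hΦ : Φ Δ = Δ := (hΔ.left_cancel Δ _ _ (h Δ)).symm
  induction n with
  | zero => exact ⟨P, hP, by simpa using Conjugates.one P⟩
  | succ n ih =>
    obtain ⟨Q, hQ, hc⟩ := ih
    refine ⟨_, hQ.map Φ hΦ, ?_⟩
    rw [pow_succ]
    refine hc.mul ⟨fun q hq => ⟨Φ q, ⟨q, hq, rfl⟩, h q⟩, ?_⟩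
    rintro _ ⟨q, hq, rfl⟩
    exact ⟨q, hq, h q⟩

/-! ## Standard parabolic subgroups and parabolic submonoids -/

/-- The subgroup generated by a parabolic submonoid. -/
def IsParabolic.toSubgroup {P : Submonoid M} (hP : IsParabolic Δ P) : ParabolicSubgroup Δ :=
  ⟨Subgroup.closure (FracGroup.ι '' (P : Set M)), P, hP, rfl⟩

theorem IsParabolic.pos_toSubgroup (hΔ : IsGarside Δ) {P : Submonoid M} (hP : IsParabolic Δ P) :
    hP.toSubgroup.pos = P := by
  ext x
  exact ⟨fun hx => hP.mem_of_ι_mem_closure hΔ hx, fun hx => Subgroup.subset_closure ⟨x, hx, rfl⟩⟩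

namespace ParabolicSubgroup

theorem ext_grp {H K : ParabolicSubgroup Δ} (h : H.grp = K.grp) : H = K := by
  cases H; cases K; cases h; rfl

theorem ext_pos {H K : ParabolicSubgroup Δ} (h : H.pos = K.pos) : H = K := by
  apply ext_grp
  rw [H.grp_eq_closure, K.grp_eq_closure, h]

theorem isParabolic_pos (hΔ : IsGarside Δ) (H : ParabolicSubgroup Δ) : IsParabolic Δ H.pos := by
  obtain ⟨P, hP, e⟩ := H.exists_submonoid
  rw [show H = hP.toSubgroup from ext_grp e, hP.pos_toSubgroup hΔ]
  exact hP

/-- A ribbon of a parabolic submonoid that belongs to it is an endomorphism. -/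
theorem eq_of_conjugates_of_mem {H K : ParabolicSubgroup Δ} {g : M}
    (h : Conjugates H.pos K.pos g) (hg : g ∈ H.pos) : K = H := by
  apply ext_grp
  have hg' : FracGroup.ι g ∈ H.grp := hg
  have hr := (isRibbon_ι h).1
  ext y
  constructor
  · intro hy
    obtain ⟨x, hx, e⟩ := hr.2 y hy
    rw [eq_inv_mul_iff_mul_eq.2 e.symm]
    exact H.grp.mul_mem (H.grp.inv_mem hg') (H.grp.mul_mem hx hg')
  · intro hy
    obtain ⟨z, hz, e⟩ := hr.1 _ (H.grp.mul_mem (H.grp.mul_mem hg' hy) (H.grp.inv_mem hg'))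
    rw [inv_mul_cancel_right] at e
    rw [mul_left_cancel e]
    exact hz

theorem isRibbon_ι_iff (hΔ : IsGarside Δ) {H K : ParabolicSubgroup Δ} {g : M} :
    IsRibbon H K (FracGroup.ι g) ↔ Conjugates H.pos K.pos g := by
  refine ⟨fun h => ⟨fun p hp => ?_, fun q hq => ?_⟩, isRibbon_ι⟩
  · obtain ⟨_, ⟨q, hq, rfl⟩, e⟩ := h.2.1 _ ⟨p, hp, rfl⟩
    exact ⟨q, hq, hΔ.ι_injective (by rw [map_mul, map_mul, e])⟩
  · obtain ⟨_, ⟨p, hp, rfl⟩, e⟩ := h.2.2 _ ⟨q, hq, rfl⟩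
    exact ⟨p, hp, hΔ.ι_injective (by rw [map_mul, map_mul, e])⟩

end ParabolicSubgroup

/-! ### Uniqueness of lcm's and transport of ribbons -/

theorem IsLeftLcm.symm {a b l : M} (h : IsLeftLcm a b l) : IsLeftLcm b a l :=
  ⟨h.2.1, h.1, fun c hb ha => h.2.2 c ha hb⟩

theorem IsLeftLcm.unique (hΔ : IsGarside Δ) {a b l m : M} (h : IsLeftLcm a b l)
    (h' : IsLeftLcm a b m) : l = m :=
  hΔ.dvd_antisymm (h.2.2 m h'.1 h'.2.1) (h'.2.2 l h.1 h.2.1)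

/-- Transport of a ribbon endomorphism along a ribbon, from the target to the source. -/
theorem Conjugates.pullback (hΔ : IsGarside Δ) {P Q : Submonoid M} {w t t' : M}
    (hw : Conjugates P Q w) (ht : Conjugates Q Q t) (e : t' * w = w * t) : Conjugates P P t' :=
  Conjugates.of_mul_right hΔ (e ▸ hw.mul ht) hw

/-- Transport of a ribbon endomorphism along a ribbon, from the source to the target. -/
theorem Conjugates.pushforward (hΔ : IsGarside Δ) {P Q : Submonoid M} {w t t' : M}
    (hw : Conjugates P Q w) (ht : Conjugates P P t') (e : t' * w = w * t) : Conjugates Q Q t :=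
  Conjugates.of_mul_left hΔ (e ▸ ht.mul hw) hw

/-- A ribbon from `P` to `Q` which belongs to `P` satisfies `Q = P`. -/
theorem Conjugates.target_eq_of_mem (hΔ : IsGarside Δ) {P Q : Submonoid M} {g : M}
    (hP : IsParabolic Δ P) (hQ : IsParabolic Δ Q) (h : Conjugates P Q g) (hg : g ∈ P) : Q = P := by
  have e : hQ.toSubgroup = hP.toSubgroup :=
    ParabolicSubgroup.eq_of_conjugates_of_mem (g := g)
      (by rwa [hP.pos_toSubgroup hΔ, hQ.pos_toSubgroup hΔ]) (by rwa [hP.pos_toSubgroup hΔ])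
  rw [← hP.pos_toSubgroup hΔ, ← e, hQ.pos_toSubgroup hΔ]

/-! ## Ribbon atoms -/

namespace IsRibbonAtom

variable {P Q : Submonoid M} {a : M}

theorem conj (h : IsRibbonAtom Δ P Q a) : Conjugates P Q a := h.1.conj

theorem ne_one (h : IsRibbonAtom Δ P Q a) : a ≠ 1 := h.2.1

/-- A nontrivial ribbon which left-divides a ribbon atom is equal to it. -/
theorem eq_of_dvd (hΔ : IsGarside Δ) {R : Submonoid M} {b : M} (ha : IsRibbonAtom Δ P Q a)
    (hb : IsPosRibbon Δ P R b) (hb1 : b ≠ 1) (h : b ∣ a) : b = a := by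
  obtain ⟨k, rfl⟩ := h
  have := (ha.2.2 R b k hb ⟨hb.target, ha.1.target, ha.conj.of_mul_left hΔ hb.conj⟩ rfl).resolve_left
    hb1
  rw [this, mul_one]

/-- Conjugation by a ribbon from `P` to `Q` sends the ribbon atoms of `P` that it maps into `Q`
to ribbon atoms. -/
theorem pushforward (hΔ : IsGarside Δ) {b c : M} (ha : IsRibbonAtom Δ P P a)
    (hb : IsPosRibbon Δ P Q b) (hc : c ∈ Q) (e : a * b = b * c) : IsRibbonAtom Δ Q Q c := by
  refine ⟨⟨hb.target, hb.target, hb.conj.pushforward hΔ ha.conj e⟩, ?_, ?_⟩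
  · rintro rfl
    exact ha.ne_one (hΔ.right_cancel b _ _ (by rw [e, one_mul, mul_one]))
  · rintro R h k hh hk rfl
    -- The factors of `c` lie in `Q`, so they are endomorphisms of `Q`; pulled back along `b` they
    -- factor the ribbon atom `a`.
    obtain ⟨hhQ, hkQ⟩ := hb.target.factor_mem hΔ hc
    obtain rfl := hh.conj.target_eq_of_mem hΔ hh.source hh.target hhQ
    obtain ⟨h', hh', e₁⟩ := hb.conj.2 h hhQ
    obtain ⟨k', hk', e₂⟩ := hb.conj.2 k hkQ
    have e₃ : a = h' * k' := hΔ.right_cancel b _ _ (by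
      rw [e, mul_assoc h', e₂, ← mul_assoc, ← mul_assoc, e₁])
    refine (ha.2.2 P h' k' ⟨hb.source, hb.source, hb.conj.pullback hΔ hh.conj e₁⟩
      ⟨hb.source, hb.source, hb.conj.pullback hΔ hk.conj e₂⟩ e₃).imp ?_ ?_
    · rintro rfl
      exact hΔ.left_cancel b _ _ (by rw [← e₁, one_mul, mul_one])
    · rintro rfl
      exact hΔ.left_cancel b _ _ (by rw [← e₂, one_mul, mul_one])

end IsRibbonAtom

namespace IsNuFunction

variable {ν : Submonoid M → M → M} {P Q : Submonoid M} {a b : M}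

/-- Ribbon atoms are values of the ν-function. -/
theorem exists_eq_of_isRibbonAtom (hΔ : IsGarside Δ) (hν : IsNuFunction Δ ν)
    (ha : IsRibbonAtom Δ P Q a) : ∃ s, IsMonoidAtom s ∧ a = ν P s := by
  obtain ⟨s, hs, hsa⟩ := hΔ.exists_atom_dvd ha.ne_one
  obtain ⟨h₁, h₂, -⟩ := hν P ha.1.source
  obtain ⟨R, hR⟩ := h₁ s hs
  exact ⟨s, hs, (ha.eq_of_dvd hΔ hR.1 hR.ne_one (h₂ s hs Q a ha.1 hsa)).symm⟩

/-- A nontrivial ribbon is left-divisible by a ribbon atom. -/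
theorem exists_isRibbonAtom_dvd (hΔ : IsGarside Δ) (hν : IsNuFunction Δ ν)
    (ha : IsPosRibbon Δ P Q a) (ha1 : a ≠ 1) : ∃ R b, IsRibbonAtom Δ P R b ∧ b ∣ a := by
  obtain ⟨s, hs, hsa⟩ := hΔ.exists_atom_dvd ha1
  obtain ⟨h₁, h₂, -⟩ := hν P ha.source
  obtain ⟨R, hR⟩ := h₁ s hs
  exact ⟨R, _, hR, h₂ s hs Q a ha hsa⟩

/-- The lcm of two ribbon atoms is a ribbon. -/
theorem exists_isPosRibbon_lcm (hΔ : IsGarside Δ) (hν : IsNuFunction Δ ν) {Q' : Submonoid M}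
    {l : M} (ha : IsRibbonAtom Δ P Q a) (hb : IsRibbonAtom Δ P Q' b) (hl : IsLeftLcm a b l) :
    ∃ R, IsPosRibbon Δ P R l := by
  obtain ⟨s, hs, rfl⟩ := hν.exists_eq_of_isRibbonAtom hΔ ha
  obtain ⟨t, ht, rfl⟩ := hν.exists_eq_of_isRibbonAtom hΔ hb
  exact (hν P ha.1.source).2.2 s t hs ht l hl

/-- The lcm of a ribbon atom `a` of `P` that lies in `P` and of another ribbon atom `b`
is `a * b`. -/
theorem isLeftLcm_mul (hΔ : IsGarside Δ) (hν : IsNuFunction Δ ν)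
    (ha : IsRibbonAtom Δ P P a) (haP : a ∈ P) (hb : IsRibbonAtom Δ P Q b) (hab : a ≠ b) :
    IsLeftLcm a b (a * b) := by
  obtain ⟨c, hc, e⟩ := hb.conj.1 a haP
  -- The conjugate `c` of `a` by `b` is again a ribbon atom. The lcm is `b * v` with `v ∣ c`; as `v
  -- ≠ 1`, it follows that `v = c`.
  have hcat := ha.pushforward hΔ hb.1 hc e
  obtain ⟨l, hl⟩ := hΔ.left_lcm a b
  obtain ⟨R, hR⟩ := hν.exists_isPosRibbon_lcm hΔ ha hb hl
  obtain ⟨v, rfl⟩ := hl.2.1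
  have hv : IsPosRibbon Δ Q R v := ⟨hb.1.target, hR.target, hR.conj.of_mul_left hΔ hb.conj⟩
  obtain ⟨w, hw⟩ := hl.2.2 (a * b) (dvd_mul_right _ _) ⟨c, e⟩
  have hvc : v ∣ c := ⟨w, hΔ.left_cancel b _ _ (by rw [← e, hw, mul_assoc])⟩
  have hv1 : v ≠ 1 := by
    rintro rfl
    rw [mul_one] at hl
    exact hab (hb.eq_of_dvd hΔ ha.1 ha.ne_one hl.1)
  rwa [e, ← hcat.eq_of_dvd hΔ hv hv1 hvc]

end IsNuFunction

/-! ## Paths in the quiver of the ν-function -/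

namespace NuQuiver

variable {ν : Submonoid M → M → M}

theorem pathVal_comp {X Y Z : NuQuiver Δ ν} (p : Quiver.Path X Y) (q : Quiver.Path Y Z) :
    pathVal (p.comp q) = pathVal p * pathVal q := by
  induction q with
  | nil => simp [pathVal]
  | cons q a ih => simp [pathVal, ih, mul_assoc]

theorem pathVal_toPath {X Y : NuQuiver Δ ν} (a : X ⟶ Y) : pathVal a.toPath = val a :=
  one_mul _

theorem isNuPath_comp {X Y Z : NuQuiver Δ ν} (p : Quiver.Path X Y) (q : Quiver.Path Y Z) :
    IsNuPath (p.comp q) ↔ IsNuPath p ∧ IsNuPath q := by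
  induction q with
  | nil => simp [IsNuPath]
  | cons q a ih => simp [IsNuPath, ih, and_assoc]

theorem ext_pos {X Y : NuQuiver Δ ν} (h : X.pos = Y.pos) : X = Y :=
  ParabolicSubgroup.ext_pos h

theorem isParabolic_pos (hΔ : IsGarside Δ) (X : NuQuiver Δ ν) : IsParabolic Δ X.pos :=
  ParabolicSubgroup.isParabolic_pos hΔ X.toParabolic

theorem exists_pos_eq (hΔ : IsGarside Δ) (ν : Submonoid M → M → M) {P : Submonoid M}
    (hP : IsParabolic Δ P) : ∃ X : NuQuiver Δ ν, X.pos = P :=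
  ⟨hP.toSubgroup, hP.pos_toSubgroup hΔ⟩

theorem isRibbonAtom_val (hΔ : IsGarside Δ) (hν : IsNuFunction Δ ν) {X Y : NuQuiver Δ ν}
    (a : X ⟶ Y) : IsRibbonAtom Δ X.pos Y.pos (val a) := by
  obtain ⟨s, hs, e⟩ := a.2.1
  obtain ⟨Q, hQ⟩ := (hν X.pos a.2.2.source).1 s hs
  rw [← e] at hQ
  exact (a.2.2.conj.target_unique hΔ hQ.conj).symm ▸ hQ

theorem exists_val_eq (hΔ : IsGarside Δ) (hν : IsNuFunction Δ ν) {X Y : NuQuiver Δ ν} {g : M}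
    (h : IsRibbonAtom Δ X.pos Y.pos g) : ∃ a : X ⟶ Y, val a = g :=
  ⟨⟨g, hν.exists_eq_of_isRibbonAtom hΔ h, h.1⟩, rfl⟩

theorem conjugates_pathVal {X Y : NuQuiver Δ ν} (p : Quiver.Path X Y) :
    Conjugates X.pos Y.pos (pathVal p) := by
  induction p with
  | nil => exact Conjugates.one _
  | cons p a ih => exact ih.mul a.2.2.conj

/-- Every positive ribbon is the value of a path. -/
theorem exists_pathVal_eq (hΔ : IsGarside Δ) (hν : IsNuFunction Δ ν) (g : M)
    {X Y : NuQuiver Δ ν} (h : Conjugates X.pos Y.pos g) :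
    ∃ p : Quiver.Path X Y, pathVal p = g := by
  induction g using hΔ.wellFounded_properFactor.induction generalizing X with
  | _ g ih =>
    by_cases hg : g = 1
    · subst hg
      obtain rfl := ext_pos (h.target_unique hΔ (Conjugates.one _))
      exact ⟨.nil, rfl⟩
    · obtain ⟨R, b, hb, k, rfl⟩ := hν.exists_isRibbonAtom_dvd hΔ
        ⟨X.isParabolic_pos hΔ, Y.isParabolic_pos hΔ, h⟩ hg
      obtain ⟨Z, rfl⟩ := exists_pos_eq hΔ ν hb.1.target
      obtain ⟨a, rfl⟩ := exists_val_eq hΔ hν hb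
      obtain ⟨p, rfl⟩ := ih k ⟨fun e => hb.ne_one (hΔ.right_cancel k _ _ (by rw [← e, one_mul])),
        val a, 1, by simp⟩ (h.of_mul_left hΔ hb.conj)
      exact ⟨a.toPath.comp p, by rw [pathVal_comp, pathVal_toPath]⟩

theorem target_eq_of_isTau (hΔ : IsGarside Δ) {X Y : NuQuiver Δ ν} {a : X ⟶ Y} (ha : IsTau a) :
    Y = X :=
  ext_pos (a.2.2.conj.target_eq_of_mem hΔ (X.isParabolic_pos hΔ) (Y.isParabolic_pos hΔ) ha)

/-- An edge of type `τ` on a path can be moved to the beginning. -/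
theorem exists_dvd_pathVal (hΔ : IsGarside Δ) (hν : IsNuFunction Δ ν) {X Y : NuQuiver Δ ν}
    (p : Quiver.Path X Y) (hp : ¬ IsNuPath p) :
    ∃ t ∈ X.pos, t ≠ 1 ∧ Conjugates X.pos X.pos t ∧ t ∣ pathVal p := by
  induction p with
  | nil => exact absurd trivial hp
  | cons p a ih =>
    by_cases hp' : IsNuPath p
    · have ha : IsTau a := by
        by_contra ha
        exact hp ⟨hp', ha⟩
      obtain rfl := target_eq_of_isTau hΔ ha
      -- The prefix `p` is a ribbon, so it carries its target's element `val a` back to an element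
      -- `t` of the submonoid at `X`.
      obtain ⟨t, ht, e⟩ := (conjugates_pathVal p).2 _ ha
      have haa := isRibbonAtom_val hΔ hν a
      refine ⟨t, ht, ?_, (conjugates_pathVal p).pullback hΔ haa.conj e, ⟨_, e.symm⟩⟩
      rintro rfl
      exact haa.ne_one (hΔ.left_cancel (pathVal p) _ _ (by rw [← e, one_mul, mul_one]))
    · obtain ⟨t, ht, ht1, hc, hd⟩ := ih hp'
      exact ⟨t, ht, ht1, hc, hd.mul_right _⟩

/-- The lcm of two edges of type `ν` decomposes only into edges of type `ν`. -/
theorem isNuPath_of_isLeftLcm (hΔ : IsGarside Δ) (hν : IsNuFunction Δ ν)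
    {X Y Z W : NuQuiver Δ ν} {a : X ⟶ Y} {b : X ⟶ Z} (ha : IsNu a) (hb : IsNu b)
    (p : Quiver.Path X W) (hp : IsLeftLcm (val a) (val b) (pathVal p)) : IsNuPath p := by
  by_contra hnu
  obtain ⟨t, ht, ht1, hc, hd⟩ := exists_dvd_pathVal hΔ hν p hnu
  have hX := X.isParabolic_pos hΔ
  obtain ⟨R, t₀, ht₀, k, rfl⟩ := hν.exists_isRibbonAtom_dvd hΔ ⟨hX, hX, hc⟩ ht1
  have ht₀X := (hX.factor_mem hΔ ht).1
  obtain rfl := ht₀.conj.target_eq_of_mem hΔ hX ht₀.1.target ht₀X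
  obtain ⟨l, hl⟩ := (dvd_mul_right t₀ k).trans hd
  -- The lcm of `t₀` and `val c` is `t₀ * val c`; it divides `t₀ * l`, so `val c ∣ l`. For `a` and
  -- `b` together this makes `t₀ * l` divide `l`, contradicting `t₀ ≠ 1`.
  have key : ∀ {V : NuQuiver Δ ν} (c : X ⟶ V), IsNu c → val c ∣ pathVal p → val c ∣ l := by
    intro V c hcn hcp
    have hlcm := hν.isLeftLcm_mul hΔ ht₀ ht₀X (isRibbonAtom_val hΔ hν c) (by
      rintro rfl
      exact hcn ht₀X)
    obtain ⟨d, hd⟩ := hlcm.2.2 _ ⟨l, hl⟩ hcp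
    exact ⟨d, hΔ.left_cancel t₀ _ _ (by rw [← hl, hd, mul_assoc])⟩
  obtain ⟨d, hd'⟩ := hp.2.2 l (key a ha hp.1) (key b hb hp.2.1)
  exact ht₀.ne_one (hΔ.eq_one_of_eq_mul_mul (y := d) (by rw [mul_assoc, ← hd', ← hl])).1

/-! ## The relations suffice -/

/-- A vertex, as an object of the category defined by the relations. -/
def classObj (X : NuQuiver Δ ν) : Quotient (Rel Δ ν) := ⟨X⟩

/-- The class of a path modulo the congruence generated by the defining relations. -/
def pathClass {X Y : NuQuiver Δ ν} (p : Quiver.Path X Y) : classObj X ⟶ classObj Y :=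
  (Quotient.functor (Rel Δ ν)).map p

theorem pathClass_comp {X Y Z : NuQuiver Δ ν} (p : Quiver.Path X Y) (q : Quiver.Path Y Z) :
    pathClass (p.comp q) = pathClass p ≫ pathClass q :=
  (Quotient.functor (Rel Δ ν)).map_comp p q

theorem pathClass_eq_of_rel {X Y : NuQuiver Δ ν} {p q : Quiver.Path X Y} (h : Rel Δ ν p q) :
    pathClass p = pathClass q :=
  CategoryTheory.Quotient.sound _ h

/-- The lcm is `val a * val b`. If `b` is of type `τ` too, symmetry also gives `val b * val a`, so
the edges commute; otherwise conjugation by `b` turns `a` into a `τ` edge at the target of `b`. -/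
theorem exists_pathClass_eq_of_isTau (hΔ : IsGarside Δ) (hν : IsNuFunction Δ ν)
    {X Y Z : NuQuiver Δ ν} {a : X ⟶ Y} {b : X ⟶ Z} (ha : IsTau a) (hab : val a ≠ val b) {l : M}
    (hl : IsLeftLcm (val a) (val b) l) :
    ∃ (W : NuQuiver Δ ν) (p : Quiver.Path Y W) (q : Quiver.Path Z W),
      l = val a * pathVal p ∧ l = val b * pathVal q ∧
        pathClass (a.toPath.comp p) = pathClass (b.toPath.comp q) := by
  obtain rfl := target_eq_of_isTau hΔ ha
  have haa := isRibbonAtom_val hΔ hν a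
  have hba := isRibbonAtom_val hΔ hν b
  obtain rfl := hl.unique hΔ (hν.isLeftLcm_mul hΔ haa ha hba hab)
  by_cases hb : IsTau b
  · obtain rfl := target_eq_of_isTau hΔ hb
    have e := hl.symm.unique hΔ (hν.isLeftLcm_mul hΔ hba hb haa hab.symm)
    exact ⟨_, b.toPath, a.toPath, by rw [pathVal_toPath], by rw [pathVal_toPath, e],
      pathClass_eq_of_rel (.tau_tau a b ha hb e)⟩
  · obtain ⟨c, hc, e⟩ := hba.conj.1 _ ha
    obtain ⟨c, rfl⟩ := exists_val_eq hΔ hν (haa.pushforward hΔ hba.1 hc e)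
    exact ⟨_, b.toPath, c.toPath, by rw [pathVal_toPath], by rw [pathVal_toPath, e],
      pathClass_eq_of_rel (.tau_nu a b c ha hb hc e)⟩

/-- The two decompositions of the lcm of two edges are equivalent. -/
theorem exists_pathClass_eq (hΔ : IsGarside Δ) (hν : IsNuFunction Δ ν)
    {X Y Z : NuQuiver Δ ν} {a : X ⟶ Y} {b : X ⟶ Z} (hab : val a ≠ val b) {l : M}
    (hl : IsLeftLcm (val a) (val b) l) :
    ∃ (W : NuQuiver Δ ν) (p : Quiver.Path Y W) (q : Quiver.Path Z W),
      l = val a * pathVal p ∧ l = val b * pathVal q ∧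
        pathClass (a.toPath.comp p) = pathClass (b.toPath.comp q) := by
  by_cases ha : IsTau a
  · exact exists_pathClass_eq_of_isTau hΔ hν ha hab hl
  by_cases hb : IsTau b
  · obtain ⟨W, p, q, h₁, h₂, h⟩ := exists_pathClass_eq_of_isTau hΔ hν hb hab.symm hl.symm
    exact ⟨W, q, p, h₂, h₁, h.symm⟩
  have haa := isRibbonAtom_val hΔ hν a
  have hba := isRibbonAtom_val hΔ hν b
  obtain ⟨R, hR⟩ := hν.exists_isPosRibbon_lcm hΔ haa hba hl
  obtain ⟨W, rfl⟩ := exists_pos_eq hΔ ν hR.target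
  obtain ⟨⟨u, hu⟩, ⟨v, hv⟩, -⟩ := id hl
  obtain ⟨p, rfl⟩ := exists_pathVal_eq hΔ hν u (X := Y) (Y := W)
    ((hu ▸ hR.conj).of_mul_left hΔ haa.conj)
  obtain ⟨q, rfl⟩ := exists_pathVal_eq hΔ hν v (X := Z) (Y := W)
    ((hv ▸ hR.conj).of_mul_left hΔ hba.conj)
  have hp : IsNuPath (a.toPath.comp p) := isNuPath_of_isLeftLcm hΔ hν ha hb _ (by
    rwa [pathVal_comp, pathVal_toPath, ← hu])
  have hq : IsNuPath (b.toPath.comp q) := isNuPath_of_isLeftLcm hΔ hν ha hb _ (by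
    rwa [pathVal_comp, pathVal_toPath, ← hv])
  exact ⟨W, p, q, hu, hv, pathClass_eq_of_rel
    (.lcm a b p q ha hb ((isNuPath_comp _ _).1 hp).2 ((isNuPath_comp _ _).1 hq).2
      (hu ▸ hl) (hu.symm.trans hv))⟩

theorem exists_eq_toPath_comp {X Y : NuQuiver Δ ν} (p : Quiver.Path X Y) (hp : pathVal p ≠ 1) :
    ∃ (Z : NuQuiver Δ ν) (a : X ⟶ Z) (p' : Quiver.Path Z Y), p = a.toPath.comp p' := by
  have h : p.length ≠ 0 := by
    cases p with
    | nil => exact absurd rfl hp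
    | cons p a => simp
  obtain ⟨Z, a, p', e, -⟩ := p.length_ne_zero_iff_eq_comp.1 h
  exact ⟨Z, a, p', e⟩

/-- Two paths with the same value are equivalent. -/
theorem pathClass_eq_of_pathVal_eq (hΔ : IsGarside Δ) (hν : IsNuFunction Δ ν)
    {X Y : NuQuiver Δ ν} (p q : Quiver.Path X Y) (h : pathVal p = pathVal q) :
    pathClass p = pathClass q := by
  induction hg : pathVal p using hΔ.wellFounded_properFactor.induction generalizing X with
  | _ g ih =>
    subst hg
    have hnil : ∀ {V : NuQuiver Δ ν} (r : Quiver.Path X V), pathVal r = 1 → r.length = 0 := by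
      intro V r hr
      cases r with
      | nil => rfl
      | cons r a =>
        exact absurd (hΔ.eq_one_of_mul_eq_one' hr) (isRibbonAtom_val hΔ hν a).ne_one
    by_cases hp1 : pathVal p = 1
    · have hp0 := hnil p hp1
      have hq0 := hnil q (h ▸ hp1)
      obtain rfl := Quiver.Path.eq_of_length_zero p hp0
      rw [Quiver.Path.eq_nil_of_length_zero p hp0, Quiver.Path.eq_nil_of_length_zero q hq0]
    · obtain ⟨Z₁, a, p, rfl⟩ := exists_eq_toPath_comp p hp1
      obtain ⟨Z₂, b, q, rfl⟩ := exists_eq_toPath_comp q (h ▸ hp1)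
      have hfac : ∀ {V W : NuQuiver Δ ν} (c : X ⟶ V) (r : Quiver.Path V W),
          pathVal r ≠ pathVal (c.toPath.comp r) ∧
            ∃ x y, pathVal (c.toPath.comp r) = x * pathVal r * y := by
        intro V W c r
        rw [pathVal_comp, pathVal_toPath]
        refine ⟨fun e => (isRibbonAtom_val hΔ hν c).ne_one (hΔ.right_cancel (pathVal r) _ _ ?_),
          val c, 1, (mul_one _).symm⟩
        rw [← e, one_mul]
      by_cases hab : val a = val b
      · have hb : Conjugates X.pos Z₂.pos (val a) := by
          rw [hab]
          exact b.2.2.conj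
        obtain rfl : Z₁ = Z₂ := ext_pos (a.2.2.conj.target_unique hΔ hb)
        obtain rfl : a = b := Subtype.ext hab
        rw [pathClass_comp, pathClass_comp, ih _ (hfac a p) p q ?_ rfl]
        rw [pathVal_comp, pathVal_comp] at h
        exact hΔ.left_cancel _ _ _ h
      -- The common value is `l * w`. Each tail is equivalent by induction to one through `l`, and
      -- the two decompositions of `l` are equivalent.
      · obtain ⟨l, hl⟩ := hΔ.left_lcm (val a) (val b)
        obtain ⟨W, u, v, hu, hv, huv⟩ := exists_pathClass_eq hΔ hν hab hl
        have hdvd : l ∣ pathVal (a.toPath.comp p) := by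
          refine hl.2.2 _ ?_ ?_
          · rw [pathVal_comp, pathVal_toPath]
            exact dvd_mul_right _ _
          · rw [h, pathVal_comp, pathVal_toPath]
            exact dvd_mul_right _ _
        obtain ⟨w, hw⟩ := hdvd
        have hauW : Conjugates X.pos W.pos l := by
          rw [hu]
          exact a.2.2.conj.mul (conjugates_pathVal u)
        obtain ⟨w, rfl⟩ := exists_pathVal_eq hΔ hν w (X := W) (Y := Y)
          ((hw ▸ conjugates_pathVal (a.toPath.comp p)).of_mul_left hΔ hauW)
        have hp : pathVal p = pathVal (u.comp w) := by
          apply hΔ.left_cancel (val a)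
          rw [pathVal_comp, ← mul_assoc, ← hu, ← hw, pathVal_comp, pathVal_toPath]
        have hq : pathVal q = pathVal (v.comp w) := by
          apply hΔ.left_cancel (val b)
          rw [pathVal_comp, ← mul_assoc, ← hv, ← hw, h, pathVal_comp, pathVal_toPath]
        have h₁ := ih _ (hfac a p) p (u.comp w) hp rfl
        have h₂ := ih _ (h ▸ hfac b q) q (v.comp w) hq rfl
        rw [pathClass_comp, pathClass_comp] at huv
        rw [pathClass_comp, pathClass_comp, h₁, h₂, pathClass_comp, pathClass_comp,
          ← Category.assoc, ← Category.assoc, huv]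

end NuQuiver

/-! ## Groupoids of fractions -/

/-- A faithful functor from a category with common right multiples to a groupoid extends to a
faithful functor on the groupoid of formal inverses. -/
theorem faithful_freeGroupoid_lift {C G : Type*} [Category C] [Groupoid G] (F : C ⥤ G)
    [F.Faithful]
    (hOre : ∀ {X Y Z : C} (f : X ⟶ Y) (g : X ⟶ Z), ∃ (W : C) (u : Y ⟶ W) (v : Z ⟶ W),
      f ≫ u = g ≫ v) : (FreeGroupoid.lift F).Faithful := by
  have : (⊤ : MorphismProperty C).HasLeftCalculusOfFractions :=
    { exists_leftFraction := fun X Y φ => by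
        obtain ⟨W, u, v, e⟩ := hOre φ.f φ.s
        exact ⟨⟨v, u, trivial⟩, e⟩
      -- If `s ≫ f₁ = s ≫ f₂`, then `F.map s` is invertible and `F` is faithful, so `f₁ = f₂`
      -- already and the identity equalizes them.
      ext := fun X' X Y f₁ f₂ s _ h => by
        refine ⟨Y, 𝟙 Y, trivial, ?_⟩
        have h' := congrArg F.map h
        rw [F.map_comp, F.map_comp, cancel_epi] at h'
        rw [F.map_injective h'] }
  refine Functor.faithful_of_comp_of_hasLeftCalculusOfFractions (FreeGroupoid.of C) ⊤ _ ?_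
  intro X Y f g h
  rw [FreeGroupoid.lift_map_homMk, FreeGroupoid.lift_map_homMk] at h
  rw [F.map_injective h]

/-- A morphism that is a fraction of morphisms of `C` belongs to the image of the groupoid of
formal inverses of `C`. -/
theorem exists_freeGroupoid_lift_map_eq {C G : Type*} [Category C] [Groupoid G] (F : C ⥤ G)
    {X Y W : C} (g : F.obj X ⟶ F.obj Y) (p : X ⟶ W) (q : Y ⟶ W) (e : g ≫ F.map q = F.map p) :
    ∃ f : FreeGroupoid.mk X ⟶ FreeGroupoid.mk Y, (FreeGroupoid.lift F).map f = g := by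
  refine ⟨FreeGroupoid.homMk p ≫ inv (FreeGroupoid.homMk q), ?_⟩
  rw [Functor.map_comp, Functor.map_inv]
  refine (IsIso.comp_inv_eq _).2 ?_
  rw [FreeGroupoid.lift_map_homMk, FreeGroupoid.lift_map_homMk]
  exact e.symm

/-! ### Ribbons as fractions of paths -/

namespace NuQuiver

variable {ν : Submonoid M → M → M}

theorem lift_toRibbon_map {X Y : NuQuiver Δ ν} (p : Quiver.Path X Y) :
    (show X.toParabolic ⟶ Y.toParabolic from (Paths.lift (toRibbon Δ ν)).map p).1 =
      FracGroup.ι (pathVal p) := by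
  induction p with
  | nil => exact (map_one _).symm
  | cons p a ih => exact (congrArg (· * FracGroup.ι (val a)) ih).trans (map_mul _ _ _).symm

theorem lift_toRibbon_map_eq_iff (hΔ : IsGarside Δ) {X Y : NuQuiver Δ ν}
    (p q : Quiver.Path X Y) :
    (Paths.lift (toRibbon Δ ν)).map p = (Paths.lift (toRibbon Δ ν)).map q ↔
      pathVal p = pathVal q := by
  refine Subtype.ext_iff.trans ?_
  rw [← hΔ.ι_injective.eq_iff, ← lift_toRibbon_map, ← lift_toRibbon_map]

theorem pathVal_eq_of_rel {X Y : NuQuiver Δ ν} {p q : Quiver.Path X Y} (h : Rel Δ ν p q) :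
    pathVal p = pathVal q := by
  cases h with
  | tau_tau a b ha hb h => rwa [pathVal_comp, pathVal_comp, pathVal_toPath, pathVal_toPath]
  | tau_nu a b c ha hb hc h =>
    rwa [pathVal_comp, pathVal_comp, pathVal_toPath, pathVal_toPath, pathVal_toPath]
  | lcm a b p q ha hb hp hq h₁ h₂ =>
    rwa [pathVal_comp, pathVal_comp, pathVal_toPath, pathVal_toPath]

/-- Every ribbon is a fraction of positive ribbons, given by paths. -/
theorem exists_path_fraction (hΔ : IsGarside Δ) (hν : IsNuFunction Δ ν) {X Y : NuQuiver Δ ν}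
    (g : X.toParabolic ⟶ Y.toParabolic) :
    ∃ (W : NuQuiver Δ ν) (p : Quiver.Path X W) (q : Quiver.Path Y W),
      g.1 * FracGroup.ι (pathVal q) = FracGroup.ι (pathVal p) := by
  obtain ⟨a, n, e⟩ := hΔ.exists_frac g.1
  -- The denominator `Δ ^ n` of `g` is itself a ribbon from `Y` to some parabolic, so the numerator
  -- `a` is a ribbon from `X` to the same one.
  obtain ⟨Q, hQ, hc⟩ := (Y.isParabolic_pos hΔ).exists_conjugates_pow hΔ n
  obtain ⟨W, rfl⟩ := exists_pos_eq hΔ ν hQ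
  obtain ⟨q, hq⟩ := exists_pathVal_eq hΔ hν _ hc
  have hr : ParabolicSubgroup.IsRibbon X.toParabolic W.toParabolic (FracGroup.ι a) := by
    rw [← e]
    have hc' := ParabolicSubgroup.isRibbon_ι (H := Y.toParabolic) (K := W.toParabolic) hc
    exact ⟨g.2.1.mul hc'.1, g.2.2.mul hc'.2⟩
  obtain ⟨p, rfl⟩ := exists_pathVal_eq hΔ hν a ((ParabolicSubgroup.isRibbon_ι_iff hΔ).1 hr)
  exact ⟨W, p, q, by rw [hq, e]⟩

theorem exists_comp_lift_toRibbon_map_eq (hΔ : IsGarside Δ) (hν : IsNuFunction Δ ν)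
    {X Y : NuQuiver Δ ν} (g : X.toParabolic ⟶ Y.toParabolic) :
    ∃ (W : NuQuiver Δ ν) (p : Quiver.Path X W) (q : Quiver.Path Y W),
      g ≫ (show Y.toParabolic ⟶ W.toParabolic from (Paths.lift (toRibbon Δ ν)).map q) =
        (Paths.lift (toRibbon Δ ν)).map p := by
  obtain ⟨W, p, q, e⟩ := exists_path_fraction hΔ hν g
  exact ⟨W, p, q, Subtype.ext ((congrArg (g.1 * ·) (lift_toRibbon_map q)).trans
    (e.trans (lift_toRibbon_map p).symm))⟩

/-- Both values divide one power of `Δ`, which is a ribbon with source `X`; the quotients are values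
of paths, and paths with equal values are equivalent. -/
theorem exists_pathClass_comp_eq (hΔ : IsGarside Δ) (hν : IsNuFunction Δ ν)
    {X Y Z : NuQuiver Δ ν} (p : Quiver.Path X Y) (q : Quiver.Path X Z) :
    ∃ (W : NuQuiver Δ ν) (u : Quiver.Path Y W) (v : Quiver.Path Z W),
      pathClass p ≫ pathClass u = pathClass q ≫ pathClass v := by
  obtain ⟨n, y, hy⟩ := hΔ.exists_mul_eq_pow (pathVal p)
  obtain ⟨m, z, hz⟩ := hΔ.exists_mul_eq_pow (pathVal q)
  obtain ⟨Q, hQ, hc⟩ := (X.isParabolic_pos hΔ).exists_conjugates_pow hΔ (n + m)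
  obtain ⟨W, rfl⟩ := exists_pos_eq hΔ ν hQ
  have hp : pathVal p * (y * Δ ^ m) = Δ ^ (n + m) := by rw [← mul_assoc, hy, pow_add]
  have hq : pathVal q * (z * Δ ^ n) = Δ ^ (n + m) := by
    rw [← mul_assoc, hz, add_comm n m, pow_add]
  obtain ⟨u, hu⟩ := exists_pathVal_eq hΔ hν _
    ((hp ▸ hc).of_mul_left hΔ (conjugates_pathVal p))
  obtain ⟨v, hv⟩ := exists_pathVal_eq hΔ hν _
    ((hq ▸ hc).of_mul_left hΔ (conjugates_pathVal q))
  refine ⟨W, u, v, ?_⟩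
  rw [← pathClass_comp, ← pathClass_comp]
  apply pathClass_eq_of_pathVal_eq hΔ hν
  rw [pathVal_comp, pathVal_comp, hu, hv, hp, hq]

theorem exists_pathClass (X Y : NuQuiver Δ ν) (f : classObj X ⟶ classObj Y) :
    ∃ p : Quiver.Path X Y, pathClass p = f :=
  (CategoryTheory.Quotient.functor (Rel Δ ν)).map_surjective f

end NuQuiver

/-! ### Generation and presentation of the ribbon groupoid -/

open NuQuiver

theorem generatesGroupoid_toRibbon (hΔ : IsGarside Δ) {ν : Submonoid M → M → M}
    (hν : IsNuFunction Δ ν) : GeneratesGroupoid (toRibbon Δ ν) where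
  obj_bijective := Function.bijective_id
  map_injective X Y a b h := Subtype.ext (hΔ.ι_injective (congrArg Subtype.val h))
  map_surjective X Y g := by
    obtain ⟨W, p, q, e⟩ := exists_comp_lift_toRibbon_map_eq hΔ hν (X := X.as.as) (Y := Y.as.as) g
    exact exists_freeGroupoid_lift_map_eq (Paths.lift (toRibbon Δ ν)) g p q e

end Ribbon

theorem mainTheorem4 {M : Type*} [Monoid M] (Δ : M) (hΔ : Ribbon.IsGarside Δ)
    (ν ν' : Submonoid M → M → M) (hν : Ribbon.IsNuFunction Δ ν)
    (hν' : Ribbon.IsNuTildeFunction Δ ν') :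
    Ribbon.IsGroupoidPresentation (Ribbon.NuQuiver.toRibbon Δ ν) (Ribbon.NuQuiver.Rel Δ ν) := by
  have hgen := Ribbon.generatesGroupoid_toRibbon hΔ hν
  have hrel : ∀ (X Y : Paths (Ribbon.NuQuiver Δ ν)) (p q : X ⟶ Y), Ribbon.NuQuiver.Rel Δ ν p q →
      (Paths.lift (Ribbon.NuQuiver.toRibbon Δ ν)).map p =
        (Paths.lift (Ribbon.NuQuiver.toRibbon Δ ν)).map q := fun X Y p q h =>
    (Ribbon.NuQuiver.lift_toRibbon_map_eq_iff hΔ p q).2 (Ribbon.NuQuiver.pathVal_eq_of_rel h)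
  refine ⟨hgen, hrel, ?_, fun X Y => ⟨?_, ?_⟩⟩
  · refine ⟨fun X Y h => ?_, fun H => ⟨FreeGroupoid.mk (Ribbon.NuQuiver.classObj H), rfl⟩⟩
    exact congrArg (fun H : Ribbon.NuQuiver Δ ν => FreeGroupoid.mk (Ribbon.NuQuiver.classObj H)) h
  -- Faithfulness before inverting is the statement that paths with equal values are equivalent;
  -- common right multiples carry it to the groupoid of formal inverses.
  · have hF : (CategoryTheory.Quotient.lift _ (Paths.lift (Ribbon.NuQuiver.toRibbon Δ ν)) hrel).Faithful := by
      refine ⟨fun {X Y} f g h => ?_⟩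
      obtain ⟨p, rfl⟩ := Ribbon.NuQuiver.exists_pathClass X.as Y.as f
      obtain ⟨q, rfl⟩ := Ribbon.NuQuiver.exists_pathClass X.as Y.as g
      exact Ribbon.NuQuiver.pathClass_eq_of_pathVal_eq hΔ hν p q
        ((Ribbon.NuQuiver.lift_toRibbon_map_eq_iff hΔ p q).1 h)
    have := Ribbon.faithful_freeGroupoid_lift
      (CategoryTheory.Quotient.lift _ (Paths.lift (Ribbon.NuQuiver.toRibbon Δ ν)) hrel) (fun {X Y Z} f g => by
        obtain ⟨p, rfl⟩ := Ribbon.NuQuiver.exists_pathClass X.as Y.as f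
        obtain ⟨q, rfl⟩ := Ribbon.NuQuiver.exists_pathClass X.as Z.as g
        obtain ⟨W, u, v, e⟩ := Ribbon.NuQuiver.exists_pathClass_comp_eq hΔ hν p q
        exact ⟨_, _, _, e⟩)
    exact (FreeGroupoid.lift _).map_injective
  · intro g
    obtain ⟨W, p, q, e⟩ := Ribbon.NuQuiver.exists_comp_lift_toRibbon_map_eq hΔ hν
      (X := X.as.as.as) (Y := Y.as.as.as) g
    exact Ribbon.exists_freeGroupoid_lift_map_eq
      (CategoryTheory.Quotient.lift _ (Paths.lift (Ribbon.NuQuiver.toRibbon Δ ν)) hrel) g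
      (Ribbon.NuQuiver.pathClass p) (Ribbon.NuQuiver.pathClass q) e
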